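/- Let $A,B,\delta_1,\delta_2,\delta_3,E_\Gamma$ be real polynomials, $A\neq 0$, and for real $r_1,r_2,r_3$ put $$Q=\delta_1 r_1+\delta_2 r_2+\delta_3 r_3,\qquad p=AQ+B .$$ Let $\Gamma=\{e^{j\alpha}\}$ be the unit circle, and assume that $\Gamma$ is singular with respect to $(r_1,r_2)$: at every $z\in\Gamma$ the real $2\times 2$ Jacobian $\partial(\operatorname{Re}Q,\operatorname{Im}Q)/\partial(r_1,r_2)$ has rank $1$ (for example $\delta_1=1+z^2$, $\delta_2=z$, $\delta_3=1$). Let $E_\Gamma\ne 0$ be a decoupling function of $Q$ over $\Gamma$: there are real functions $g_3,g_0$ with $\operatorname{Im}\bigl(Q(e^{j\alpha})/E_\Gamma(e^{j\alpha})\bigr)=r_3g_3(\alpha)+g_0(\alpha)$ for all $r_1,r_2,r_3$ and all $\alpha$ with $E_\Gamma(e^{j\alpha})\neq0$ (for example $E_\Gamma=z$ or $E_\Gamma=1+z^2$). Fix $r_1,r_2,r_3\in\mathbb R$ and let, zeros being counted with multiplicity, - $N$ be the degree of $p$; - $R$ the number of complex zeros of $AE_\Gamma$ with $|z|<1$; -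 $J$ the number of complex zeros $\ne\pm1$ of $AE_\Gamma$ with $|z|=1$; - $J_+$, $J_-$ the orders of $+1$, $-1$ as zeros of $AE_\Gamma$ (possibly $0$); - $Z\in\{0,1,2,\dots,\infty\}$ the number of singular frequencies in $0<\alpha<\pi$ for the given $r_3$, i.e. of those $\alpha\in(0,\pi)$ for which $p(e^{j\alpha};r_1',r_2',r_3)=0$ for some $r_1',r_2'\in\mathbb R$ and $\partial(\operatorname{Re}p,\operatorname{Im}p)/\partial(r_1,r_2)$ has rank $1$ at $e^{j\alpha}$. For $m\in\mathbb N$ let $E(m)=2\lfloor m/2\rfloor$ be the largest even integer $\le m$. Let $F=p/(AE_\Gamma)$, and assume that at the zeros of $A$ on the open upper half circle (if there are any) the Mikhailov curve $\alpha\mapsto F(e^{j\alpha})$ does not go to infinity in the direction of the real axis: for every $\alpha_0\in(0,\pi)$ with $A(e^{j\alpha_0})=0$, the quotient $\operatorname{Im}F(e^{j\alpha})/|F(e^{j\alpha})|$ does not tend to $0$ as $\alpha\to\alpha_0$, $\alpha\neq\alpha_0$. If $p$ is Schur stable, i.e. all its complex zeros satisfy $|z|<1$, then $$Z\;\ge\;N-R-\frac{J+E(J_+)+E(J_-)+2}{2}.$$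 (Consequently, a value of $r_3$ for which $Z$ violates this inequality admits no stabilizing $(r_1,r_2)$ with these data.) -/

import Mathlib

open Polynomial Set Filter Topology

noncomputable section

namespace Gridding

/-- The point `e^{jα}` of the unit circle. -/
def circlePoint (α : ℝ) : ℂ := Complex.exp (α * Complex.I)

/-- The polynomial `Q = δ₁ r₁ + δ₂ r₂ + δ₃ r₃`. -/
def paramQ (δ₁ δ₂ δ₃ : ℝ[X]) (r₁ r₂ r₃ : ℝ) : ℝ[X] :=
  C r₁ * δ₁ + C r₂ * δ₂ + C r₃ * δ₃

/-- The characteristic polynomial `p = A Q + B`. -/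
def charPoly (A B δ₁ δ₂ δ₃ : ℝ[X]) (r₁ r₂ r₃ : ℝ) : ℝ[X] :=
  A * paramQ δ₁ δ₂ δ₃ r₁ r₂ r₃ + B

/-- The Jacobian `∂(H, G)/∂(r₁, r₂)` at `z`, where `H` and `G` are the real and the imaginary part
of `A (δ₁ r₁ + δ₂ r₂ + δ₃ r₃) + B` at `z`; the derivative of the latter with respect to `rᵢ`
is `A(z) δᵢ(z)`. -/
def paramJacobian (A δ₁ δ₂ : ℝ[X]) (z : ℂ) : Matrix (Fin 2) (Fin 2) ℝ :=
  !![(aeval z (A * δ₁)).re, (aeval z (A * δ₂)).re;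
     (aeval z (A * δ₁)).im, (aeval z (A * δ₂)).im]

/-- The unit circle is singular with respect to `r₁, r₂`: the Jacobian of the real and imaginary
part of `Q` has rank one at each of its points. -/
def CircleSingular (δ₁ δ₂ : ℝ[X]) : Prop :=
  ∀ z : ℂ, ‖z‖ = 1 → (paramJacobian 1 δ₁ δ₂ z).rank = 1

/-- `E` is a (polynomial) decoupling function of `Q` over the unit circle: `Q = E q`, where the
imaginary part of `q` on the circle has the form `r₃ g₃(α) + g₀(α)`. -/
def IsDecoupling (δ₁ δ₂ δ₃ E : ℝ[X]) : Prop :=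
  E ≠ 0 ∧ ∃ g₃ g₀ : ℝ → ℝ, ∀ α : ℝ, aeval (circlePoint α) E ≠ 0 → ∀ r₁ r₂ r₃ : ℝ,
    (aeval (circlePoint α) (paramQ δ₁ δ₂ δ₃ r₁ r₂ r₃) / aeval (circlePoint α) E).im
      = r₃ * g₃ α + g₀ α

/-- The Mikhailov curve `α ↦ F(e^{jα})` of `F = p / (A E)`. -/
def mikhailov (p A E : ℝ[X]) (α : ℝ) : ℂ :=
  aeval (circlePoint α) p / aeval (circlePoint α) (A * E)

/-- The argument of `F(e^{jβ})` tends to a multiple of `π` as `β → α`, i.e. the asymptotic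
direction of the Mikhailov curve at `α` is that of the real axis. -/
def RealDirectionAt (p A E : ℝ[X]) (α : ℝ) : Prop :=
  Tendsto (fun β => (mikhailov p A E β).im / ‖mikhailov p A E β‖) (𝓝[≠] α) (𝓝 0)

/-- The singular frequencies `0 < α < π` for the fixed parameter `r₃`: `e^{jα}` is a zero of the
characteristic polynomial for some `(r₁, r₂)`, and the rank condition holds at it. -/
def singularFrequencies (A B δ₁ δ₂ δ₃ : ℝ[X]) (r₃ : ℝ) : Set ℝ :=
  {α | α ∈ Ioo 0 Real.pi ∧ (paramJacobian A δ₁ δ₂ (circlePoint α)).rank = 1 ∧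
    ∃ r₁ r₂ : ℝ, aeval (circlePoint α) (charPoly A B δ₁ δ₂ δ₃ r₁ r₂ r₃) = 0}

/-- Schur stability: all complex zeros lie in the open unit disc. -/
def SchurStable (p : ℝ[X]) : Prop :=
  ∀ z : ℂ, aeval z p = 0 → ‖z‖ < 1

open Classical in
/-- Number of complex zeros inside the unit circle, with multiplicity. -/
def zerosInside (f : ℝ[X]) : ℕ :=
  Multiset.card ((f.aroots ℂ).filter fun z => ‖z‖ < 1)

open Classical in
/-- Number of complex zeros `≠ ±1` on the unit circle, with multiplicity. -/
def zerosOnCircle (f : ℝ[X]) : ℕ :=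
  Multiset.card ((f.aroots ℂ).filter fun z => ‖z‖ = 1 ∧ z ≠ 1 ∧ z ≠ -1)

/-- The largest even integer `≤ m`. -/
def evenPart (m : ℕ) : ℕ := 2 * (m / 2)

end Gridding

end

/-! On the circle `δ₁ / E` and `δ₂ / E` are real, so changing `r₁`, `r₂` only moves `F = p / (A E)`
parallel to the real axis. Where `F` is real, a suitable change brings `p` to zero; hence crossings
of the real axis by the Mikhailov curve are singular frequencies (`mem_singularFrequencies`), and it
suffices to count them.

The count is an argument principle modulo `π`. Allowing real factors of either sign keeps the phase
continuous through zeros and poles on the circle. By conjugate symmetry a zero contributes on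
average `π`, `π/2` or `0` over the upper half circle, according as it lies inside, on or outside the
circle (`exists_phase`). For stable `p` the phase of `F` thus changes by `π (N - R - (J + J₊ +
J₋)/2)`. The intermediate value theorem yields a crossing for each multiple of `π` strictly between
the end values (`le_encard_sin_eq_zero`). An odd `J₊` or `J₋` makes an end value a half-integer
multiple of `π`, and rounding there turns `J₊`, `J₋` into `E(J₊)`, `E(J₋)`. -/

namespace Gridding

/-! ### Phases modulo `π` -/

/-- `φ` is an argument of `f` modulo `π`; no condition is imposed where `f` vanishes. -/
def HasPhase (f : ℝ → ℂ) (φ : ℝ → ℝ) : Prop :=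
  ∀ α, ∃ t : ℝ, f α = t * Complex.exp (φ α * Complex.I)

theorem HasPhase.mul {f g : ℝ → ℂ} {φ ψ : ℝ → ℝ} (hf : HasPhase f φ) (hg : HasPhase g ψ) :
    HasPhase (fun α => f α * g α) (fun α => φ α + ψ α) := by
  intro α
  obtain ⟨s, hs⟩ := hf α
  obtain ⟨t, ht⟩ := hg α
  refine ⟨s * t, ?_⟩
  simp only [hs, ht, Complex.ofReal_mul, Complex.ofReal_add, add_mul, Complex.exp_add]
  ring

theorem HasPhase.div {f g : ℝ → ℂ} {φ ψ : ℝ → ℝ} (hf : HasPhase f φ) (hg : HasPhase g ψ) :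
    HasPhase (fun α => f α / g α) (fun α => φ α - ψ α) := by
  intro α
  obtain ⟨s, hs⟩ := hf α
  obtain ⟨t, ht⟩ := hg α
  refine ⟨s / t, ?_⟩
  simp only [hs, ht, Complex.ofReal_div, Complex.ofReal_sub, sub_mul, Complex.exp_sub]
  rw [div_mul_div_comm]

theorem HasPhase.pow {f : ℝ → ℂ} {φ : ℝ → ℝ} (hf : HasPhase f φ) (n : ℕ) :
    HasPhase (fun α => f α ^ n) (fun α => n * φ α) := by
  intro α
  obtain ⟨s, hs⟩ := hf α
  refine ⟨s ^ n, ?_⟩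
  simp only [hs, mul_pow, ← Complex.exp_nat_mul]
  push_cast
  ring_nf

theorem hasPhase_const (c : ℂ) : HasPhase (fun _ => c) (fun _ => c.arg) :=
  fun _ => ⟨‖c‖, (Complex.norm_mul_exp_arg_mul_I c).symm⟩

theorem continuous_circlePoint : Continuous circlePoint := by
  unfold circlePoint; fun_prop

theorem norm_circlePoint (α : ℝ) : ‖circlePoint α‖ = 1 :=
  Complex.norm_exp_ofReal_mul_I α

theorem circlePoint_zero : circlePoint 0 = 1 := by simp [circlePoint]

theorem circlePoint_pi : circlePoint Real.pi = -1 := by simp [circlePoint]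

theorem circlePoint_neg_pi : circlePoint (-Real.pi) = -1 := by
  simp [circlePoint, Complex.exp_neg]

theorem circlePoint_neg (α : ℝ) : circlePoint (-α) = (starRingEnd ℂ) (circlePoint α) := by
  simp [circlePoint, ← Complex.exp_conj]

theorem circlePoint_mul_neg (α : ℝ) : circlePoint α * circlePoint (-α) = 1 := by
  simp [circlePoint, ← Complex.exp_add]

theorem continuous_arg_one_add {w : ℝ → ℂ} (hw : Continuous w) (h : ∀ α, ‖w α‖ < 1) :
    Continuous fun α => (1 + w α).arg := by
  refine continuous_iff_continuousAt.2 fun α => ?_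
  exact (Complex.continuousAt_arg (Complex.mem_slitPlane_of_norm_lt_one (h α))).comp
    (f := fun α => 1 + w α) (by fun_prop)

theorem hasPhase_arg (f : ℝ → ℂ) : HasPhase f (fun α => (f α).arg) :=
  fun α => ⟨‖f α‖, (Complex.norm_mul_exp_arg_mul_I (f α)).symm⟩

/-! ### Phase change of linear factors over the full circle -/

/-- Write `w - z = w (1 - z w⁻¹)`: the second factor stays in the right half plane, so its principal
argument is continuous and only `w` winds. -/
theorem exists_phase_of_norm_lt_one {z : ℂ} (hz : ‖z‖ < 1) :
    ∃ φ : ℝ → ℝ, Continuous φ ∧ HasPhase (fun α => circlePoint α - z) φ ∧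
      φ Real.pi - φ (-Real.pi) = 2 * Real.pi := by
  have hc : Continuous fun α : ℝ => -(z * circlePoint (-α)) := by
    have := continuous_circlePoint
    fun_prop
  refine ⟨fun α => α + (1 + -(z * circlePoint (-α))).arg, ?_, ?_, ?_⟩
  · refine continuous_id.add (continuous_arg_one_add hc fun α => ?_)
    simpa [norm_circlePoint] using hz
  · have h1 : HasPhase circlePoint (fun α => α) := fun α => ⟨1, by simp [circlePoint]⟩
    have h2 := h1.mul (hasPhase_arg fun α => 1 + -(z * circlePoint (-α)))
    intro α
    obtain ⟨t, ht⟩ := h2 α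
    refine ⟨t, ht ▸ ?_⟩
    linear_combination z * circlePoint_mul_neg α
  · simp only [neg_neg, circlePoint_pi, circlePoint_neg_pi]
    ring

theorem exists_phase_of_one_lt_norm {z : ℂ} (hz : 1 < ‖z‖) :
    ∃ φ : ℝ → ℝ, Continuous φ ∧ HasPhase (fun α => circlePoint α - z) φ ∧
      φ Real.pi - φ (-Real.pi) = 0 := by
  have hz0 : z ≠ 0 := by rintro rfl; norm_num at hz
  have hc : Continuous fun α : ℝ => -(circlePoint α / z) := by
    have := continuous_circlePoint
    fun_prop
  refine ⟨fun α => (-z).arg + (1 + -(circlePoint α / z)).arg, ?_, ?_, ?_⟩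
  · refine continuous_const.add (continuous_arg_one_add hc fun α => ?_)
    rw [norm_neg, norm_div, norm_circlePoint]
    exact (div_lt_one (by linarith)).2 hz
  · have h2 := (hasPhase_const (-z)).mul (hasPhase_arg fun α => 1 + -(circlePoint α / z))
    intro α
    obtain ⟨t, ht⟩ := h2 α
    refine ⟨t, ht ▸ ?_⟩
    field_simp
    ring
  · simp only [circlePoint_pi, circlePoint_neg_pi]
    ring

/-- The chord is `2 sin((α - β)/2)` times `i e^{j(α+β)/2}`. The real factor absorbs the sign change
at `β`, leaving a phase that is affine in `α`. -/
theorem hasPhase_circlePoint_sub (β : ℝ) :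
    HasPhase (fun α => circlePoint α - circlePoint β) (fun α => α / 2 + (β / 2 + Real.pi / 2)) := by
  intro α
  refine ⟨2 * Real.sin ((α - β) / 2), ?_⟩
  have hI : Complex.exp ((Real.pi : ℂ) / 2 * Complex.I) = Complex.I := Complex.exp_pi_div_two_mul_I
  have e1 : circlePoint α = Complex.exp (((α + β) / 2 : ℂ) * Complex.I) *
      Complex.exp (((α - β) / 2 : ℂ) * Complex.I) := by
    rw [circlePoint, ← Complex.exp_add]; ring_nf
  have e2 : circlePoint β = Complex.exp (((α + β) / 2 : ℂ) * Complex.I) *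
      Complex.exp (-((α - β) / 2 : ℂ) * Complex.I) := by
    rw [circlePoint, ← Complex.exp_add]; ring_nf
  have e3 : Complex.exp (((α / 2 + (β / 2 + Real.pi / 2) : ℝ) : ℂ) * Complex.I) =
      Complex.exp (((α + β) / 2 : ℂ) * Complex.I) * Complex.I := by
    rw [show Complex.exp (((α + β) / 2 : ℂ) * Complex.I) * Complex.I = _ * _ from
      congrArg _ hI.symm, ← Complex.exp_add]
    push_cast; ring_nf
  simp only [e1, e2, e3, Complex.ofReal_mul, Complex.ofReal_sin, Complex.sin]
  push_cast
  linear_combination (Complex.exp (((α + β) / 2 : ℂ) * Complex.I) *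
    (Complex.exp (((α - β) / 2 : ℂ) * Complex.I) -
      Complex.exp (-((α - β) / 2 : ℂ) * Complex.I))) * Complex.I_sq

theorem exists_phase_of_norm_eq_one {z : ℂ} (hz : ‖z‖ = 1) :
    ∃ φ : ℝ → ℝ, Continuous φ ∧ HasPhase (fun α => circlePoint α - z) φ ∧
      φ Real.pi - φ (-Real.pi) = Real.pi := by
  obtain ⟨β, rfl⟩ := (Complex.norm_eq_one_iff z).1 hz
  exact ⟨_, by fun_prop, hasPhase_circlePoint_sub β, by ring⟩

open Classical in
theorem exists_phase_prod (s : Multiset ℂ) :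
    ∃ φ : ℝ → ℝ, Continuous φ ∧ HasPhase (fun α => (s.map fun z => circlePoint α - z).prod) φ ∧
      φ Real.pi - φ (-Real.pi) = Real.pi * (2 * Multiset.card (s.filter fun z => ‖z‖ < 1)
        + Multiset.card (s.filter fun z => ‖z‖ = 1)) := by
  induction s using Multiset.induction_on with
  | empty => exact ⟨fun _ => 0, continuous_const, fun α => ⟨1, by simp⟩, by simp⟩
  | cons z s ih =>
    obtain ⟨ψ, hψc, hψ, hψd⟩ := ih
    rcases lt_trichotomy ‖z‖ 1 with h | h | h
    · obtain ⟨φ, hφc, hφ, hφd⟩ := exists_phase_of_norm_lt_one h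
      refine ⟨fun α => φ α + ψ α, hφc.add hψc, by simpa using hφ.mul hψ, ?_⟩
      rw [Multiset.filter_cons_of_pos (p := fun z : ℂ => ‖z‖ < 1) _ h, Multiset.filter_cons_of_neg (p := fun z : ℂ => ‖z‖ = 1) _ h.ne, Multiset.card_cons]
      push_cast
      linear_combination hφd + hψd
    · obtain ⟨φ, hφc, hφ, hφd⟩ := exists_phase_of_norm_eq_one h
      refine ⟨fun α => φ α + ψ α, hφc.add hψc, by simpa using hφ.mul hψ, ?_⟩
      rw [Multiset.filter_cons_of_neg (p := fun z : ℂ => ‖z‖ < 1) _ h.not_lt,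
        Multiset.filter_cons_of_pos (p := fun z : ℂ => ‖z‖ = 1) _ h,
        Multiset.card_cons]
      push_cast
      linear_combination hφd + hψd
    · obtain ⟨φ, hφc, hφ, hφd⟩ := exists_phase_of_one_lt_norm h
      refine ⟨fun α => φ α + ψ α, hφc.add hψc, by simpa using hφ.mul hψ, ?_⟩
      rw [Multiset.filter_cons_of_neg (p := fun z : ℂ => ‖z‖ < 1) _ h.not_gt,
        Multiset.filter_cons_of_neg (p := fun z : ℂ => ‖z‖ = 1) _ h.ne']
      linear_combination hφd + hψd

/-! ### Phase change of a real polynomial over the upper half circle -/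

theorem aeval_eq_prod_aroots (f : ℝ[X]) (w : ℂ) :
    aeval w f = (f.leadingCoeff : ℂ) * ((f.aroots ℂ).map fun z => w - z).prod := by
  have h := (IsAlgClosed.splits (f.map (algebraMap ℝ ℂ))).eq_prod_roots
  rw [← eval_map_algebraMap]
  nth_rewrite 1 [h]
  rw [eval_mul, eval_C, eval_multiset_prod, Multiset.map_map, leadingCoeff_map]
  simp [aroots]

theorem dense_aeval_circlePoint_ne_zero {f : ℝ[X]} (hf : f ≠ 0) :
    Dense {α : ℝ | aeval (circlePoint α) f ≠ 0} := by
  have hfin : {z : ℂ | aeval z f = 0}.Countable :=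
    (f.rootSet_finite ℂ).countable.mono fun z hz => (mem_rootSet.2 ⟨hf, hz⟩)
  have h1 := hfin.preimage_cexp.preimage
    (f := fun α : ℝ => (α : ℂ) * Complex.I) fun a b hab => by simpa using hab
  exact h1.dense_compl ℝ

/-- The range is connected and lies in the countable set of multiples of `π`, so it is a single
point. -/
theorem eq_of_sin_eq_zero {g : ℝ → ℝ} (hg : Continuous g) (h : ∀ x, Real.sin (g x) = 0)
    (a b : ℝ) : g a = g b := by
  have hc : (Set.range fun n : ℤ => (n : ℝ) * Real.pi).Countable := Set.countable_range _
  refine hc.isTotallyDisconnected (Set.range g) ?_ (isPreconnected_range hg) ⟨a, rfl⟩ ⟨b, rfl⟩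
  rintro _ ⟨x, rfl⟩
  obtain ⟨n, hn⟩ := Real.sin_eq_zero_iff.1 (h x)
  exact ⟨n, hn⟩

theorem im_ofReal_mul_exp (t θ : ℝ) :
    ((t : ℂ) * Complex.exp (θ * Complex.I)).im = t * Real.sin θ := by
  rw [Complex.im_ofReal_mul, Complex.exp_ofReal_mul_I_im]

/-- Two phases of conjugate-symmetric values add up to a multiple of `π`. -/
theorem phase_symm {f : ℝ[X]} (hf : f ≠ 0) {φ : ℝ → ℝ} (hφc : Continuous φ)
    (hφ : HasPhase (fun α => aeval (circlePoint α) f) φ) (a : ℝ) :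
    φ a + φ (-a) = 2 * φ 0 := by
  -- The sum is a phase of `f(w)` times its conjugate, which is real. This determines it modulo `π`
  -- off the zeros of `f`, and by density everywhere.
  have key : (fun α => Real.sin (φ α + φ (-α))) = fun _ => 0 := by
    refine Continuous.ext_on (dense_aeval_circlePoint_ne_zero hf) (by fun_prop) continuous_const
      fun α hα => ?_
    obtain ⟨s, hs⟩ := hφ α
    obtain ⟨t, ht⟩ := hφ (-α)
    simp only [circlePoint_neg, aeval_conj] at hs ht
    have hα' : aeval (circlePoint α) f ≠ 0 := hα
    have hs0 : s ≠ 0 := by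
      rintro rfl
      exact hα' (by simpa using hs)
    have ht0 : t ≠ 0 := by
      rintro rfl
      exact hα' (by simpa using ht)
    have hreal : aeval (circlePoint α) f * (starRingEnd ℂ) (aeval (circlePoint α) f) =
        ((s * t : ℝ) : ℂ) * Complex.exp (((φ α + φ (-α) : ℝ) : ℂ) * Complex.I) := by
      rw [ht, hs, Complex.ofReal_add, add_mul, Complex.exp_add]
      push_cast
      ring
    rw [Complex.mul_conj] at hreal
    have h := congrArg Complex.im hreal
    rw [Complex.ofReal_im, im_ofReal_mul_exp] at h
    exact (mul_eq_zero.1 h.symm).resolve_left (mul_ne_zero hs0 ht0)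
  have := eq_of_sin_eq_zero (g := fun α => φ α + φ (-α)) (by fun_prop) (fun x => congrFun key x) a 0
  simpa [two_mul] using this

theorem sin_phase_eq_zero {f : ℝ[X]} {φ : ℝ → ℝ}
    (hφ : HasPhase (fun α => aeval (circlePoint α) f) φ) {α x : ℝ} (hx : circlePoint α = x)
    (h : f.eval x ≠ 0) : Real.sin (φ α) = 0 := by
  obtain ⟨t, ht⟩ := hφ α
  have e : aeval (x : ℂ) f = ((f.eval x : ℝ) : ℂ) := by
    simpa using aeval_algebraMap_apply ℂ x f
  simp only [hx, e] at ht
  have h1 := congrArg Complex.im ht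
  rw [Complex.ofReal_im, im_ofReal_mul_exp] at h1
  refine (mul_eq_zero.1 h1.symm).resolve_left ?_
  rintro rfl
  exact h (by simpa using ht)

theorem zerosInside_X_sub_C_pow_mul {g : ℝ[X]} (hg : g ≠ 0) {a : ℝ} (ha : |a| = 1) (n : ℕ) :
    zerosInside ((X - C a) ^ n * g) = zerosInside g := by
  have h0 : (X - C a) ^ n * g ≠ 0 := mul_ne_zero (pow_ne_zero _ (X_sub_C_ne_zero a)) hg
  rw [zerosInside, aroots_mul h0, aroots_pow, aroots_X_sub_C, Multiset.filter_add,
    Multiset.nsmul_singleton, Multiset.card_add, zerosInside, add_eq_right, Multiset.card_eq_zero,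
    Multiset.filter_eq_nil]
  intro z hz
  rw [Multiset.eq_of_mem_replicate hz]
  simp [ha]

theorem zerosOnCircle_X_sub_C_pow_mul {g : ℝ[X]} (hg : g ≠ 0) {a : ℝ} (ha : a = 1 ∨ a = -1)
    (n : ℕ) : zerosOnCircle ((X - C a) ^ n * g) = zerosOnCircle g := by
  have h0 : (X - C a) ^ n * g ≠ 0 := mul_ne_zero (pow_ne_zero _ (X_sub_C_ne_zero a)) hg
  rw [zerosOnCircle, aroots_mul h0, aroots_pow, aroots_X_sub_C, Multiset.filter_add,
    Multiset.nsmul_singleton, Multiset.card_add, zerosOnCircle, add_eq_right,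
    Multiset.card_eq_zero, Multiset.filter_eq_nil]
  intro z hz
  rw [Multiset.eq_of_mem_replicate hz]
  rcases ha with rfl | rfl <;> simp

theorem exists_phase_of_eval_ne_zero {g : ℝ[X]} (h1 : g.eval 1 ≠ 0) (h2 : g.eval (-1) ≠ 0) :
    ∃ φ : ℝ → ℝ, Continuous φ ∧ HasPhase (fun α => aeval (circlePoint α) g) φ ∧
      φ Real.pi - φ 0 = Real.pi * (zerosInside g + zerosOnCircle g / 2) ∧
      Real.sin (φ 0) = 0 ∧ Real.sin (φ Real.pi) = 0 := by
  classical
  have hg : g ≠ 0 := by rintro rfl; simp at h1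
  obtain ⟨ψ, hψc, hψ, hψd⟩ := exists_phase_prod (g.aroots ℂ)
  have hφ := (hasPhase_const (g.leadingCoeff : ℂ)).mul hψ
  simp only [← aeval_eq_prod_aroots] at hφ
  have hφc : Continuous fun α => (g.leadingCoeff : ℂ).arg + ψ α := by fun_prop
  refine ⟨_, hφc, hφ, ?_, sin_phase_eq_zero hφ (x := 1) (by simp [circlePoint_zero]) h1,
    sin_phase_eq_zero hφ (x := -1) (by simp [circlePoint_pi]) h2⟩
  -- Symmetry makes the change over `[0, π]` half of that over `[-π, π]`.
  have hs := phase_symm hg hφc hφ Real.pi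
  have e1 : zerosInside g = Multiset.card ((g.aroots ℂ).filter fun z => ‖z‖ < 1) := by
    rw [zerosInside]
  have e2 : zerosOnCircle g = Multiset.card ((g.aroots ℂ).filter fun z => ‖z‖ = 1) := by
    rw [zerosOnCircle]
    congr 1
    refine Multiset.filter_congr fun z hz => ?_
    have hz0 : aeval z g = 0 := (mem_aroots.1 hz).2
    refine and_iff_left ⟨?_, ?_⟩
    · rintro rfl
      apply h1
      have := aeval_algebraMap_apply ℂ (1 : ℝ) g
      simpa [hz0] using this.symm
    · rintro rfl
      apply h2
      have := aeval_algebraMap_apply ℂ (-1 : ℝ) g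
      simpa [hz0] using this.symm
  rw [e1, e2]
  linear_combination hψd / 2 + hs / 2

/-- A polynomial has a continuous phase on the unit circle; its change over the upper half circle
counts the zeros, and its endpoint values are determined modulo `π` by the orders at `±1`. -/
theorem exists_phase {f : ℝ[X]} (hf : f ≠ 0) :
    ∃ φ : ℝ → ℝ, Continuous φ ∧ HasPhase (fun α => aeval (circlePoint α) f) φ ∧
      φ Real.pi - φ 0 = Real.pi * (zerosInside f +
        (zerosOnCircle f + f.rootMultiplicity 1 + f.rootMultiplicity (-1)) / 2) ∧
      (∃ k : ℤ, φ 0 = (k + (f.rootMultiplicity 1 : ℝ) / 2) * Real.pi) ∧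
      ∃ k : ℤ, φ Real.pi = (k + (f.rootMultiplicity (-1) : ℝ) / 2) * Real.pi := by
  obtain ⟨q, hq, hq1⟩ := exists_eq_pow_rootMultiplicity_mul_and_not_dvd f hf 1
  have hq0 : q ≠ 0 := by rintro rfl; simp at hq1
  obtain ⟨g, hg, hg2⟩ := exists_eq_pow_rootMultiplicity_mul_and_not_dvd q hq0 (-1)
  have hg0 : g ≠ 0 := by rintro rfl; simp at hg2
  have hn : f.rootMultiplicity (-1) = q.rootMultiplicity (-1) := by
    have h0 : ((X - C (1 : ℝ)) ^ f.rootMultiplicity 1).rootMultiplicity (-1) = 0 := by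
      refine rootMultiplicity_eq_zero ?_
      rw [IsRoot, eval_pow, eval_sub, eval_X, eval_C]
      exact pow_ne_zero _ (by norm_num)
    conv_lhs => rw [hq]
    rw [rootMultiplicity_mul (hq ▸ hf), h0, zero_add]
  rw [hn]
  generalize q.rootMultiplicity (-1) = n at *
  generalize f.rootMultiplicity 1 = m at *
  have h1 : g.eval 1 ≠ 0 := fun h =>
    hq1 (hg ▸ (dvd_iff_isRoot.2 h).mul_left _)
  have h2 : g.eval (-1) ≠ 0 := fun h => hg2 (dvd_iff_isRoot.2 h)
  obtain ⟨φ, hφc, hφ, hφd, hs0, hsπ⟩ := exists_phase_of_eval_ne_zero h1 h2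
  have hm := (hasPhase_circlePoint_sub 0).pow m
  have hn := (hasPhase_circlePoint_sub Real.pi).pow n
  have hf' : f = (X - C 1) ^ m * ((X - C (-1)) ^ n * g) := by rw [← hg, ← hq]
  -- Each factor at `1` has phase `α/2 + π/2`, each at `-1` has `α/2 + π`: a half-integer multiple
  -- of `π` arises exactly at the angle of the zero itself.
  refine ⟨fun α => m * (α / 2 + (0 / 2 + Real.pi / 2)) +
    (n * (α / 2 + (Real.pi / 2 + Real.pi / 2)) + φ α), by fun_prop, ?_, ?_, ?_, ?_⟩
  · convert hm.mul (hn.mul hφ) using 2 with α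
    simp [hf', circlePoint_zero, circlePoint_pi]
  · rw [hf', zerosInside_X_sub_C_pow_mul (hg ▸ hq0) (by simp),
      zerosInside_X_sub_C_pow_mul hg0 (by simp),
      zerosOnCircle_X_sub_C_pow_mul (hg ▸ hq0) (by simp),
      zerosOnCircle_X_sub_C_pow_mul hg0 (by simp)]
    linear_combination hφd
  · obtain ⟨k, hk⟩ := Real.sin_eq_zero_iff.1 hs0
    refine ⟨k + n, ?_⟩
    push_cast
    linear_combination -hk
  · obtain ⟨k, hk⟩ := Real.sin_eq_zero_iff.1 hsπ
    refine ⟨k + m + n, ?_⟩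
    push_cast
    linear_combination -hk

/-! ### Counting crossings of the real axis -/

/-- By the intermediate value theorem a continuous function passes every multiple of `π` strictly
between its values at the endpoints. -/
theorem le_encard_sin_eq_zero {θ : ℝ → ℝ} (hθ : Continuous θ) {a b : ℝ} (hab : a ≤ b) :
    (((⌈θ b / Real.pi⌉ - ⌊θ a / Real.pi⌋ - 1).toNat : ℕ) : ℕ∞)
      ≤ {α | α ∈ Ioo a b ∧ Real.sin (θ α) = 0}.encard := by
  have hpi := Real.pi_pos
  set u := ⌊θ a / Real.pi⌋
  set v := ⌈θ b / Real.pi⌉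
  -- With this rounding, `u < k < v` says exactly that `k π` lies strictly between the end values.
  have h : ∀ k : ℤ, k ∈ Ioo u v → ∃ α ∈ Ioo a b, θ α = k * Real.pi := by
    rintro k ⟨hk1, hk2⟩
    refine intermediate_value_Ioo hab hθ.continuousOn ⟨?_, ?_⟩
    · exact (div_lt_iff₀ hpi).1 (Int.floor_lt.1 hk1)
    · exact (lt_div_iff₀ hpi).1 (Int.lt_ceil.1 hk2)
  choose! x hx hxθ using h
  have hcard : (Ioo u v).encard = ((v - u - 1).toNat : ℕ) := by
    rw [← Finset.coe_Ioo, Set.encard_coe_eq_coe_finsetCard, Int.card_Ioo]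
  rw [← hcard]
  refine Set.encard_le_encard_of_injOn (f := x) (fun k hk => ⟨hx k hk, ?_⟩) fun k hk l hl hkl => ?_
  · rw [hxθ k hk, Real.sin_int_mul_pi]
  · have := hxθ k hk
    rw [hkl, hxθ l hl] at this
    exact_mod_cast (mul_right_cancel₀ hpi.ne' this).symm

/-! ### From crossings to singular frequencies -/

theorem paramJacobian_eq_mul (A δ₁ δ₂ : ℝ[X]) (z : ℂ) :
    paramJacobian A δ₁ δ₂ z =
      !![(aeval z A).re, -(aeval z A).im; (aeval z A).im, (aeval z A).re] *
        paramJacobian 1 δ₁ δ₂ z := by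
  ext i j
  fin_cases i <;> fin_cases j <;>
    simp [paramJacobian, Complex.mul_re, Complex.mul_im, Matrix.mul_apply, Fin.sum_univ_two] <;>
    ring

/-- Multiplication by `A(z)` is real linear on the plane with determinant `|A(z)|²`. -/
theorem rank_paramJacobian {A : ℝ[X]} (δ₁ δ₂ : ℝ[X]) {z : ℂ} (hz : aeval z A ≠ 0) :
    (paramJacobian A δ₁ δ₂ z).rank = (paramJacobian 1 δ₁ δ₂ z).rank := by
  rw [paramJacobian_eq_mul]
  refine Matrix.rank_mul_eq_right_of_isUnit_det _ _ (isUnit_iff_ne_zero.2 ?_)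
  have : Complex.normSq (aeval z A) ≠ 0 := by simpa using hz
  rw [Matrix.det_fin_two_of]
  rw [Complex.normSq_apply] at this
  convert this using 1
  ring

theorem CircleSingular.aeval_ne_zero {δ₁ δ₂ : ℝ[X]} (h : CircleSingular δ₁ δ₂) {z : ℂ}
    (hz : ‖z‖ = 1) : aeval z δ₁ ≠ 0 ∨ aeval z δ₂ ≠ 0 := by
  by_contra! hc
  have h0 : paramJacobian 1 δ₁ δ₂ z = 0 := by
    ext i j
    fin_cases i <;> fin_cases j <;> simp [paramJacobian, hc.1, hc.2]
  have := h z hz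
  rw [h0, Matrix.rank_zero] at this
  exact zero_ne_one this

theorem IsDecoupling.im_div_eq_zero {δ₁ δ₂ δ₃ E : ℝ[X]} (h : IsDecoupling δ₁ δ₂ δ₃ E) {α : ℝ}
    (hα : aeval (circlePoint α) E ≠ 0) :
    (aeval (circlePoint α) δ₁ / aeval (circlePoint α) E).im = 0 ∧
      (aeval (circlePoint α) δ₂ / aeval (circlePoint α) E).im = 0 := by
  obtain ⟨-, g₃, g₀, hg⟩ := h
  have h0 := hg α hα 0 0 0
  have h1 := hg α hα 1 0 0
  have h2 := hg α hα 0 1 0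
  simp only [paramQ, C_1, zero_mul, one_mul, add_zero, zero_add, map_zero, zero_div,
    Complex.zero_im] at h0 h1 h2
  exact ⟨h1.trans h0.symm, h2.trans h0.symm⟩

/-- Where the phase of `p / (A E)` is a multiple of `π`, the product of `p` with the conjugate of
`A δ` is real if `δ / E` is real along the circle. -/
theorem im_mul_conj_eq_zero {p A E δ : ℝ[X]} (hAE : A * E ≠ 0)
    (hδ : ∀ α, aeval (circlePoint α) E ≠ 0 →
      (aeval (circlePoint α) δ / aeval (circlePoint α) E).im = 0)
    {θ : ℝ → ℝ} (hθc : Continuous θ) (hθ : HasPhase (mikhailov p A E) θ) {α : ℝ}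
    (hα : Real.sin (θ α) = 0) :
    (aeval (circlePoint α) p * (starRingEnd ℂ) (aeval (circlePoint α) (A * δ))).im = 0 := by
  have hcont : ∀ f : ℝ[X], Continuous fun α => aeval (circlePoint α) f := fun f =>
    f.continuous_aeval.comp continuous_circlePoint
  have hc1 := hcont p
  have hc2 := hcont (A * δ)
  -- Where `A E ≠ 0`, `δ = s E` and `p = t e^{jθ} A E` with `s`, `t` real, so the product is `t s |A
  -- E|²`. Having no denominators, the identity extends by continuity to the zeros of `A E`.
  have key : (fun α => (aeval (circlePoint α) p * (starRingEnd ℂ) (aeval (circlePoint α) (A * δ))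
      * Complex.exp ((-θ α : ℝ) * Complex.I)).im) = fun _ => 0 := by
    refine Continuous.ext_on (dense_aeval_circlePoint_ne_zero hAE) ?_ continuous_const
      fun β hβ => ?_
    · have hc3 : Continuous fun α => (starRingEnd ℂ) (aeval (circlePoint α) (A * δ)) :=
        Complex.continuous_conj.comp hc2
      fun_prop
    have hβ' : aeval (circlePoint β) (A * E) ≠ 0 := hβ
    have hE : aeval (circlePoint β) E ≠ 0 := fun h => hβ' (by simp [h])
    obtain ⟨t, ht⟩ := hθ β
    obtain ⟨s, hs⟩ : ∃ s : ℝ, aeval (circlePoint β) δ = s * aeval (circlePoint β) E := by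
      refine ⟨(aeval (circlePoint β) δ / aeval (circlePoint β) E).re, ?_⟩
      rw [← div_eq_iff hE]
      exact Complex.ext rfl (hδ β hE)
    rw [mikhailov, div_eq_iff hβ'] at ht
    have hexp : Complex.exp (θ β * Complex.I) * Complex.exp ((-θ β : ℝ) * Complex.I) = 1 := by
      rw [← Complex.exp_add]
      simp
    have e : aeval (circlePoint β) p * (starRingEnd ℂ) (aeval (circlePoint β) (A * δ))
        * Complex.exp ((-θ β : ℝ) * Complex.I) =
        ((t * s * Complex.normSq (aeval (circlePoint β) (A * E)) : ℝ) : ℂ) := by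
      rw [ht, map_mul (aeval (circlePoint β)) A δ, hs]
      push_cast at hexp ⊢
      rw [← Complex.mul_conj, map_mul (aeval (circlePoint β)) A E]
      simp only [map_mul, Complex.conj_ofReal]
      linear_combination (t * s * (aeval (circlePoint β) A * aeval (circlePoint β) E *
        ((starRingEnd ℂ) (aeval (circlePoint β) A) * (starRingEnd ℂ) (aeval (circlePoint β) E)))
          : ℂ) * hexp
    simp only [e, Complex.ofReal_im]
  -- At `α` the factor `e^{-jθ}` is `±1` and can be dropped.
  have h := congrFun key α
  simp only [Complex.mul_im _ (Complex.exp _), Complex.exp_ofReal_mul_I_im,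
    Complex.exp_ofReal_mul_I_re, Real.sin_neg, hα, Real.cos_neg, neg_zero, mul_zero,
    zero_add] at h
  refine (mul_eq_zero.1 h).resolve_right fun hcos => ?_
  have := Real.sin_sq_add_cos_sq (θ α)
  rw [hα, hcos] at this
  norm_num at this

/-- The quotient is `±sin θ`, or `0` by the convention `0 / 0 = 0`, so `|sin θ|` bounds it. -/
theorem realDirectionAt_of_sin_eq_zero {p A E : ℝ[X]} {θ : ℝ → ℝ} (hθc : Continuous θ)
    (hθ : HasPhase (mikhailov p A E) θ) {α : ℝ} (hα : Real.sin (θ α) = 0) :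
    RealDirectionAt p A E α := by
  have hlim : Tendsto (fun β => |Real.sin (θ β)|) (𝓝[≠] α) (𝓝 0) := by
    have : Continuous fun β => |Real.sin (θ β)| := by fun_prop
    simpa [hα] using (this.tendsto α).mono_left nhdsWithin_le_nhds
  refine squeeze_zero_norm (fun β => ?_) hlim
  obtain ⟨t, ht⟩ := hθ β
  rw [ht, im_ofReal_mul_exp, norm_mul, Complex.norm_exp_ofReal_mul_I, mul_one, Complex.norm_real,
    norm_div, norm_norm, norm_mul, Real.norm_eq_abs, Real.norm_eq_abs]
  rcases eq_or_ne t 0 with rfl | h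
  · simp
  · rw [mul_div_cancel_left₀ _ (abs_ne_zero.2 h)]

theorem exists_real_shift {p a : ℂ} (ha : a ≠ 0) (h : (p * (starRingEnd ℂ) a).im = 0) :
    ∃ r : ℝ, p + r * a = 0 := by
  refine ⟨-((p * (starRingEnd ℂ) a).re / Complex.normSq a), ?_⟩
  have hn : (Complex.normSq a : ℂ) ≠ 0 := by simpa using ha
  have e : ((p * (starRingEnd ℂ) a).re : ℂ) = p * (starRingEnd ℂ) a :=
    Complex.ext rfl h.symm
  push_cast
  rw [e]
  field_simp
  rw [← Complex.mul_conj]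
  ring

/-- The direction hypothesis rules out zeros of `A`. The rank condition makes `δ₁` or `δ₂` nonzero
at the point, and shifting the corresponding parameter cancels `p`. -/
theorem mem_singularFrequencies {A B δ₁ δ₂ δ₃ E : ℝ[X]} {r₁ r₂ r₃ : ℝ} (hA : A ≠ 0)
    (hsing : CircleSingular δ₁ δ₂) (hE : IsDecoupling δ₁ δ₂ δ₃ E)
    (hdir : ∀ α ∈ Ioo 0 Real.pi, aeval (circlePoint α) A = 0 →
      ¬ RealDirectionAt (charPoly A B δ₁ δ₂ δ₃ r₁ r₂ r₃) A E α)
    {θ : ℝ → ℝ} (hθc : Continuous θ)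
    (hθ : HasPhase (mikhailov (charPoly A B δ₁ δ₂ δ₃ r₁ r₂ r₃) A E) θ) {α : ℝ}
    (hα : α ∈ Ioo 0 Real.pi) (hsin : Real.sin (θ α) = 0) :
    α ∈ singularFrequencies A B δ₁ δ₂ δ₃ r₃ := by
  have hAα : aeval (circlePoint α) A ≠ 0 := fun h =>
    hdir α hα h (realDirectionAt_of_sin_eq_zero hθc hθ hsin)
  have hAE := mul_ne_zero hA hE.1
  refine ⟨hα, ?_, ?_⟩
  · rw [rank_paramJacobian _ _ hAα, hsing _ (norm_circlePoint α)]
  rcases hsing.aeval_ne_zero (norm_circlePoint α) with h | h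
  · obtain ⟨r, hr⟩ := exists_real_shift (by simpa using ⟨hAα, h⟩)
      (im_mul_conj_eq_zero hAE (fun β hβ => (hE.im_div_eq_zero hβ).1) hθc hθ hsin)
    refine ⟨r₁ + r, r₂, ?_⟩
    simp only [charPoly, paramQ, map_add, map_mul, aeval_C, Complex.coe_algebraMap] at hr ⊢
    linear_combination hr
  · obtain ⟨r, hr⟩ := exists_real_shift (by simpa using ⟨hAα, h⟩)
      (im_mul_conj_eq_zero hAE (fun β hβ => (hE.im_div_eq_zero hβ).2) hθc hθ hsin)
    refine ⟨r₁, r₂ + r, ?_⟩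
    simp only [charPoly, paramQ, map_add, map_mul, aeval_C, Complex.coe_algebraMap] at hr ⊢
    linear_combination hr

/-! ### Stable polynomials and rounding -/

theorem SchurStable.ne_zero {p : ℝ[X]} (h : SchurStable p) : p ≠ 0 := by
  rintro rfl
  simpa using h 1 (by simp)

theorem SchurStable.zerosInside_eq {p : ℝ[X]} (h : SchurStable p) :
    zerosInside p = p.natDegree := by
  rw [zerosInside, Multiset.filter_eq_self.2 fun z hz => h z (mem_aroots.1 hz).2,
    IsAlgClosed.card_aroots_eq_natDegree]

theorem SchurStable.zerosOnCircle_eq {p : ℝ[X]} (h : SchurStable p) : zerosOnCircle p = 0 := by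
  rw [zerosOnCircle, Multiset.card_eq_zero, Multiset.filter_eq_nil]
  exact fun z hz h1 => (h z (mem_aroots.1 hz).2).ne h1.1

theorem SchurStable.rootMultiplicity_eq_zero {p : ℝ[X]} (h : SchurStable p) {x : ℝ}
    (hx : |x| = 1) : p.rootMultiplicity x = 0 := by
  refine Polynomial.rootMultiplicity_eq_zero fun h0 => ?_
  have e : aeval (x : ℂ) p = ((p.eval x : ℝ) : ℂ) := by
    simpa using aeval_algebraMap_apply ℂ x p
  have := h x (by rw [e, h0.eq_zero, Complex.ofReal_zero])
  simp [hx] at this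

theorem evenPart_eq_sub_mod (m : ℕ) : (evenPart m : ℝ) = m - (m % 2 : ℕ) := by
  have := Nat.div_add_mod m 2
  rw [evenPart, eq_sub_iff_add_eq]
  exact_mod_cast this

/-- The half gained for odd `m` is what replaces an order by its even part. -/
theorem floor_intCast_add_half_le (k : ℤ) (m : ℕ) :
    (⌊(k : ℝ) + m / 2⌋ : ℝ) ≤ k + m / 2 - (m % 2 : ℕ) / 2 := by
  have hm := Nat.div_add_mod m 2
  set q := m / 2
  rcases Nat.mod_two_eq_zero_or_one m with h | h
  · rw [h]
    simpa using Int.floor_le ((k : ℝ) + m / 2)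
  · rw [h] at hm ⊢
    have h1 : (m : ℝ) = 2 * q + 1 := by exact_mod_cast hm.symm
    have h2 : ⌊(k : ℝ) + m / 2⌋ < k + q + 1 := by
      rw [Int.floor_lt]
      push_cast
      linarith
    have h3 : (⌊(k : ℝ) + m / 2⌋ : ℝ) ≤ k + q := by exact_mod_cast Int.le_of_lt_add_one h2
    push_cast
    linarith

end Gridding

theorem mainTheorem1 (A B δ₁ δ₂ δ₃ E : ℝ[X]) (r₁ r₂ r₃ : ℝ)
    (hA : A ≠ 0)
    (hsing : Gridding.CircleSingular δ₁ δ₂)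
    (hE : Gridding.IsDecoupling δ₁ δ₂ δ₃ E)
    (hdir : ∀ α ∈ Ioo 0 Real.pi, aeval (Gridding.circlePoint α) A = 0 →
      ¬ Gridding.RealDirectionAt (Gridding.charPoly A B δ₁ δ₂ δ₃ r₁ r₂ r₃) A E α)
    (hstable : Gridding.SchurStable (Gridding.charPoly A B δ₁ δ₂ δ₃ r₁ r₂ r₃)) :
    ((((Gridding.charPoly A B δ₁ δ₂ δ₃ r₁ r₂ r₃).natDegree : ℝ)
        - (Gridding.zerosInside (A * E) : ℝ)
        - ((Gridding.zerosOnCircle (A * E) : ℝ)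
            + (Gridding.evenPart ((A * E).rootMultiplicity 1) : ℝ)
            + (Gridding.evenPart ((A * E).rootMultiplicity (-1)) : ℝ) + 2) / 2 : ℝ) : EReal)
      ≤ (((Gridding.singularFrequencies A B δ₁ δ₂ δ₃ r₃).encard : ENNReal) : EReal) := by
  open Gridding in
  obtain ⟨φ, hφc, hφ, hφd, ⟨k₀, hk₀⟩, ⟨k₁, hk₁⟩⟩ := exists_phase hstable.ne_zero
  obtain ⟨ψ, hψc, hψ, hψd, ⟨l₀, hl₀⟩, ⟨l₁, hl₁⟩⟩ := exists_phase (mul_ne_zero hA hE.1)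
  rw [hstable.rootMultiplicity_eq_zero (by simp), Nat.cast_zero, zero_div, add_zero] at hk₀ hk₁
  rw [hstable.rootMultiplicity_eq_zero (by simp), hstable.rootMultiplicity_eq_zero (by simp),
    hstable.zerosInside_eq, hstable.zerosOnCircle_eq] at hφd
  have hθc := hφc.sub hψc
  have hsub := (le_encard_sin_eq_zero hθc Real.pi_pos.le).trans (Set.encard_le_encard
    fun α hα => mem_singularFrequencies hA hsing hE hdir hθc (hφ.div hψ) hα.1 hα.2)
  have hpi := Real.pi_pos.ne'
  set m₀ := (A * E).rootMultiplicity 1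
  set m₁ := (A * E).rootMultiplicity (-1)
  -- The pole order enters as `-m₀/2`, rewritten as `-m₀ + m₀/2` to fit the floor estimate.
  have e₀ : (φ 0 - ψ 0) / Real.pi = ((k₀ - l₀ - m₀ : ℤ) : ℝ) + m₀ / 2 := by
    rw [hk₀, hl₀]
    field_simp
    push_cast
    ring
  -- The outer minus sign turns the ceiling at `π` into a floor, so one estimate serves both ends.
  have e₁ : (φ Real.pi - ψ Real.pi) / Real.pi = -(((l₁ - k₁ : ℤ) : ℝ) + m₁ / 2) := by
    rw [hk₁, hl₁]
    field_simp
    push_cast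
    ring
  have hD : (φ Real.pi - ψ Real.pi) / Real.pi - (φ 0 - ψ 0) / Real.pi =
      (charPoly A B δ₁ δ₂ δ₃ r₁ r₂ r₃).natDegree -
        (zerosInside (A * E) + (zerosOnCircle (A * E) + m₀ + m₁) / 2) := by
    rw [← sub_div, div_eq_iff hpi]
    push_cast at hφd
    linear_combination hφd - hψd
  have hf₀ := floor_intCast_add_half_le (k₀ - l₀ - m₀) m₀
  have hf₁ := floor_intCast_add_half_le (l₁ - k₁) m₁
  rw [← e₀] at hf₀
  have hc : (⌈(φ Real.pi - ψ Real.pi) / Real.pi⌉ : ℝ) = -⌊((l₁ - k₁ : ℤ) : ℝ) + m₁ / 2⌋ := by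
    rw [e₁, Int.ceil_neg, Int.cast_neg]
  set n := (⌈(φ Real.pi - ψ Real.pi) / Real.pi⌉ - ⌊(φ 0 - ψ 0) / Real.pi⌋ - 1).toNat
  have hle : (⌈(φ Real.pi - ψ Real.pi) / Real.pi⌉ - ⌊(φ 0 - ψ 0) / Real.pi⌋ - 1 : ℝ) ≤ (n : ℝ) := by
    exact_mod_cast Int.self_le_toNat _
  have hbound : ((charPoly A B δ₁ δ₂ δ₃ r₁ r₂ r₃).natDegree : ℝ) - zerosInside (A * E)
      - (zerosOnCircle (A * E) + evenPart m₀ + evenPart m₁ + 2) / 2 ≤ (n : ℝ) := by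
    rw [evenPart_eq_sub_mod, evenPart_eq_sub_mod]
    linarith
  refine (EReal.coe_le_coe_iff.2 hbound).trans ?_
  have h1 : ((n : ℕ∞) : ENNReal) ≤ ((singularFrequencies A B δ₁ δ₂ δ₃ r₃).encard : ENNReal) :=
    ENat.toENNReal_le.2 hsub
  rw [ENat.toENNReal_coe, ← ENNReal.ofReal_natCast] at h1
  have h2 := EReal.coe_ennreal_le_coe_ennreal_iff.2 h1
  rwa [EReal.coe_ennreal_ofReal, max_eq_left n.cast_nonneg] at h2
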